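/- Let $M\ge 2$ be an integer and $P>0$. For $\alpha\ge 0$ consider the channel $Y_i=X_i+Z_i$ with noisy feedback $\tilde Y_i=Y_i+\tilde Z_i$, $i=1,2,\dots$, where the $Z_i$ are i.i.d. $\mathrm N(0,1)$, the $\tilde Z_i$ are i.i.d. $\mathrm N(0,\alpha)$ (identically $0$ if $\alpha=0$, the noise-free feedback case), and the two sequences are independent. An $(M,n)$ code consists of (measurable) encoding functions $x_i(w,\tilde y^{\,i-1})$, $w\in\{1,\dots,M\}$, $1\le i\le n$, which give the channel inputs $X_i=x_i(w,\tilde Y^{i-1})$, and a (measurable) decoding function $\hat w(y^n)\in\{1,\dots,M\}$. It satisfies the peak energy constraint if, for every message $w$, $\sum_{i=1}^n x_i(w,\tilde Y^{i-1})^2\le nP$ with probability one. Its error probability is $P_e^{(n)}=\frac1M\sum_{w=1}^M \mathsf P\{\hat w(Y^n)\neq w\mid W=w\}$. Let $P_e^*(M,n)$ be the infimum of $P_e^{(n)}$ over all $(M,n)$ codes that satisfy the peak energy constraint, and let $$E_M(\alpha)=\limsup_{n\to\infty}-\frac1n\ln P_e^*(M,n).$$ Then, as the feedback noise vanishes, the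 noisy-feedback exponent converges to the noise-free one: $$\lim_{\alpha\to0^+}E_M(\alpha)=E_M(0)=\frac P2 .$$ -/

import Mathlib

open MeasureTheory ProbabilityTheory Filter Topology
open scoped NNReal ENNReal

namespace GaussianFeedback

/-- An `(M, n)` code for the channel with feedback: measurable encoding functions
`x_i(w, ỹ^{i-1})`, where the input at time `i` depends on the message `w` and on the feedback
symbols received strictly before time `i`, and a measurable decoding function `ŵ(y^n)`. -/
structure Code (M n : ℕ) where
  enc : (i : Fin n) → Fin M → (Fin (i : ℕ) → ℝ) → ℝ
  measurable_enc : ∀ i w, Measurable (enc i w)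
  dec : (Fin n → ℝ) → Fin M
  measurable_dec : Measurable dec

/-- The joint law of `(Z^n, Z̃^n)`: the forward noise is i.i.d. `N(0, 1)`, the backward noise is
i.i.d. `N(0, α)` (a point mass at `0` if `α = 0`), and the two are independent. -/
noncomputable def noise (n : ℕ) (α : ℝ≥0) : Measure ((Fin n → ℝ) × (Fin n → ℝ)) :=
  (Measure.pi fun _ => gaussianReal 0 1).prod (Measure.pi fun _ => gaussianReal 0 α)

namespace Code

variable {M n : ℕ}

/-- The channel output `Y_i = x_i(w, Ỹ^{i-1}) + Z_i` with `Ỹ_j = Y_j + Z̃_j`, as a function of the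
message `w` and the noise realizations `ω = (z, z̃)`. -/
noncomputable def output (c : Code M n) (w : Fin M) (ω : (Fin n → ℝ) × (Fin n → ℝ))
    (i : Fin n) : ℝ :=
  c.enc i w (fun j : Fin (i : ℕ) =>
    c.output w ω ⟨j, j.isLt.trans i.isLt⟩ + ω.2 ⟨j, j.isLt.trans i.isLt⟩) + ω.1 i
termination_by (i : ℕ)
decreasing_by exact j.isLt

/-- The noisy feedback symbol `Ỹ_i = Y_i + Z̃_i`. -/
noncomputable def feedback (c : Code M n) (w : Fin M) (ω : (Fin n → ℝ) × (Fin n → ℝ))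
    (i : Fin n) : ℝ :=
  c.output w ω i + ω.2 i

/-- The channel input `X_i = x_i(w, Ỹ^{i-1})`. -/
noncomputable def input (c : Code M n) (w : Fin M) (ω : (Fin n → ℝ) × (Fin n → ℝ))
    (i : Fin n) : ℝ :=
  c.enc i w (fun j : Fin (i : ℕ) => c.feedback w ω ⟨j, j.isLt.trans i.isLt⟩)

/-- The peak energy constraint: for every message, `∑ X_i² ≤ nP` with probability one. -/
def PeakEnergy (c : Code M n) (P : ℝ) (α : ℝ≥0) : Prop :=
  ∀ w : Fin M, ∀ᵐ ω ∂(noise n α), ∑ i : Fin n, (c.input w ω i) ^ 2 ≤ n * P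

/-- The probability of error for a uniformly distributed message:
`(1/M) ∑_w P(Ŵ(Y^n) ≠ w | W = w)`. -/
noncomputable def errorProb (c : Code M n) (α : ℝ≥0) : ℝ≥0∞ :=
  (M : ℝ≥0∞)⁻¹ * ∑ w : Fin M, noise n α {ω | c.dec (c.output w ω) ≠ w}

end Code

/-- `P_e^*(M, n)`: the best error probability over all `(M, n)` codes that satisfy the peak energy
constraint. -/
noncomputable def bestErrorProb (M n : ℕ) (P : ℝ) (α : ℝ≥0) : ℝ≥0∞ :=
  ⨅ (c : Code M n) (_ : c.PeakEnergy P α), c.errorProb α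

/-- The best error exponent `E_M(α) = limsup_n -(1/n) ln P_e^*(M, n)`, as an extended real number
(with `ln 0 = -∞`). -/
noncomputable def errorExponent (M : ℕ) (P : ℝ) (α : ℝ≥0) : EReal :=
  limsup (fun n : ℕ => -(1 / (n : EReal)) * ENNReal.log (bestErrorProb M n P α)) atTop

end GaussianFeedback

/-! Upper bound `P / 2`, for every `α`: given a message, the pair (output, feedback noise) has a
density with respect to pure noise, namely exp(∑ x y - ∑ x² / 2) (`Code.lintegral_output`). Under
pure noise the decoder knows nothing of the message, so some message is missed with probability at
least 1/2. The energy constraint gives ∑ x² ≤ nP, and ∑ x y is a martingale, below -εn only with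
exponentially small probability. So the density is at least exp(-(P/2 + ε)n) on most of the error
event (`Code.PeakEnergy.le_measure_error`).

Lower bound: a linear scheme uses the channel a fixed number `k` of times. It sends a point `w * d`
of small energy, then each time `-b` times the noise it has just seen, with `b` slightly above 1.
The linear estimate telescopes to `w * d` up to b⁻ᵏ times the next input and a weighted sum of
feedback noises. Decoding can thus fail only if the forward noise of `k` uses has energy above about
nP, or the feedback noise has energy above nq (`exists_code_errorProb_le`). For fixed `k` the first
event has exponent about P/2; for small `α` the second is no more likely to exponential order
(`exists_bestErrorProb_le`). -/

namespace GaussianFeedback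

/-! ### Change of measure for causal Gaussian shifts. -/

/-- The likelihood ratio of `N(c, 1)` with respect to `N(0, 1)`. -/
noncomputable def shiftDensity (c x : ℝ) : ℝ≥0∞ := ENNReal.ofReal (Real.exp (c * x - c ^ 2 / 2))

@[fun_prop]
lemma Measurable.shiftDensity {Ω : Type*} [MeasurableSpace Ω] {f g : Ω → ℝ} (hf : Measurable f)
    (hg : Measurable g) : Measurable fun ω => shiftDensity (f ω) (g ω) := by
  unfold GaussianFeedback.shiftDensity
  fun_prop

lemma lintegral_gaussianReal_add (c : ℝ) {f : ℝ → ℝ≥0∞} (hf : Measurable f) :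
    ∫⁻ x, f (c + x) ∂(gaussianReal 0 1) = ∫⁻ x, f x * shiftDensity c x ∂(gaussianReal 0 1) := by
  have h1 : ∫⁻ x, f (c + x) ∂(gaussianReal 0 1) = ∫⁻ x, f x ∂(gaussianReal c 1) := by
    have := gaussianReal_map_const_add (μ := 0) (v := 1) c
    rw [zero_add] at this
    rw [← this, lintegral_map hf (by fun_prop)]
  rw [h1, gaussianReal_of_var_ne_zero _ one_ne_zero, gaussianReal_of_var_ne_zero _ one_ne_zero,
    lintegral_withDensity_eq_lintegral_mul _ (measurable_gaussianPDF _ _) hf,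
    lintegral_withDensity_eq_lintegral_mul _ (measurable_gaussianPDF _ _)
      (g := fun x => f x * shiftDensity c x) (hf.mul (by fun_prop))]
  refine lintegral_congr fun x => ?_
  simp only [Pi.mul_apply]
  have : gaussianPDF c 1 x = gaussianPDF 0 1 x * shiftDensity c x := by
    rw [gaussianPDF, gaussianPDF, shiftDensity,
      ← ENNReal.ofReal_mul (gaussianPDFReal_nonneg _ _ _), gaussianPDFReal, gaussianPDFReal,
      mul_assoc (√(2 * Real.pi * ((1 : ℝ≥0) : ℝ)))⁻¹, ← Real.exp_add]
    congr 3
    simp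
    ring
  rw [this]
  ring

/-- The shift `ξ` ignores coordinate `k`, so it is a constant once the other coordinates are fixed,
and the one-dimensional formula applies to the marginal in `k`. -/
lemma lintegral_pi_update_add {n : ℕ} (k : Fin n) {ξ : (Fin n → ℝ) → ℝ} (hξm : Measurable ξ)
    (hξ : ∀ y t, ξ (Function.update y k t) = ξ y) {f : (Fin n → ℝ) → ℝ≥0∞} (hf : Measurable f) :
    ∫⁻ y, f (Function.update y k (ξ y + y k)) ∂(Measure.pi fun _ => gaussianReal 0 1)
      = ∫⁻ y, f y * shiftDensity (ξ y) (y k) ∂(Measure.pi fun _ => gaussianReal 0 1) := by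
  have hu : Measurable fun y : Fin n → ℝ => Function.update y k (ξ y + y k) := by
    refine measurable_pi_lambda _ fun i => ?_
    by_cases h : i = k
    · subst h; simp only [Function.update_self]; fun_prop
    · simp only [Function.update_of_ne h]; fun_prop
  refine lintegral_eq_of_lmarginal_eq {k} (hf.comp hu) (by fun_prop) ?_
  rw [lmarginal_singleton, lmarginal_singleton]
  funext y
  simp only [hξ, Function.update_self, Function.update_idem]
  exact lintegral_gaussianReal_add (ξ y) (f := fun t => f (Function.update y k t))
    (hf.comp (measurable_update y))

/-- A discrete Girsanov formula. Coordinates are shifted one at a time in increasing order; each new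
shift depends only on coordinates already replaced by those of `F z`. -/
lemma lintegral_pi_causal_shift {n : ℕ} {ξ : Fin n → (Fin n → ℝ) → ℝ}
    (hξm : ∀ i, Measurable (ξ i)) (hξ : ∀ i y y', (∀ j < i, y j = y' j) → ξ i y = ξ i y')
    {F : (Fin n → ℝ) → (Fin n → ℝ)} (hF : ∀ z i, F z i = ξ i (F z) + z i)
    {f : (Fin n → ℝ) → ℝ≥0∞} (hf : Measurable f) :
    ∫⁻ z, f (F z) ∂(Measure.pi fun _ => gaussianReal 0 1)
      = ∫⁻ y, f y * ∏ i, shiftDensity (ξ i y) (y i) ∂(Measure.pi fun _ => gaussianReal 0 1) := by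
  have key : ∀ k ≤ n, ∀ f : (Fin n → ℝ) → ℝ≥0∞, Measurable f →
      ∫⁻ z, f (fun i => if (i : ℕ) < k then F z i else z i) ∂(Measure.pi fun _ => gaussianReal 0 1)
      = ∫⁻ y, f y * ∏ i with (i : Fin n).val < k, shiftDensity (ξ i y) (y i)
          ∂(Measure.pi fun _ => gaussianReal 0 1) := by
    intro k
    induction k with
    | zero => intro _ f _; simp
    | succ k ih =>
      intro hk f hf
      obtain ⟨κ, hκ⟩ : ∃ κ : Fin n, (κ : ℕ) = k := ⟨⟨k, hk⟩, rfl⟩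
      have hupd : ∀ y t, ∀ i : Fin n, (i : ℕ) ≤ k → ξ i (Function.update y κ t) = ξ i y := by
        intro y t i hi
        refine hξ i _ _ fun j hj => Function.update_of_ne ?_ _ _
        rintro rfl
        simp [Fin.lt_def, hκ] at hj
        omega
      have hu : Measurable fun y : Fin n → ℝ => Function.update y κ (ξ κ y + y κ) := by
        refine measurable_pi_lambda _ fun i => ?_
        by_cases h : i = κ
        · subst h; simp only [Function.update_self]; fun_prop
        · simp only [Function.update_of_ne h]; fun_prop
      -- The hybrid sequence with `k + 1` shifted coordinates is the one with `k`, shifted at `κ`: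
      -- the shift `ξ κ` sees only earlier coordinates, where the hybrid agrees with `F z`.
      have h1 : ∀ z, (fun i : Fin n => if (i : ℕ) < k + 1 then F z i else z i)
          = Function.update (fun i : Fin n => if (i : ℕ) < k then F z i else z i) κ
            (ξ κ (fun i : Fin n => if (i : ℕ) < k then F z i else z i) +
              (fun i : Fin n => if (i : ℕ) < k then F z i else z i) κ) := by
        intro z
        funext i
        by_cases h : i = κ
        · subst h
          simp only [Function.update_self, hκ, Nat.lt_succ_self, if_true, lt_irrefl, if_false]
          rw [hF]
          congr 1
          refine hξ _ _ _ fun j hj => ?_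
          rw [Fin.lt_def] at hj
          simp [hκ ▸ hj]
        · have : (i : ℕ) ≠ k := fun h' => h (Fin.ext (h'.trans hκ.symm))
          rw [Function.update_of_ne h]
          simp only [show (i : ℕ) < k + 1 ↔ (i : ℕ) < k by omega]
      simp_rw [h1]
      rw [ih (by omega) (fun y => f (Function.update y κ (ξ κ y + y κ))) (hf.comp hu)]
      -- The earlier factors do not see coordinate `κ`, so they can be absorbed into the integrand
      -- before the one-coordinate lemma is applied.
      have h2 : ∀ y, ∏ i with (i : Fin n).val < k, shiftDensity (ξ i y) (y i)
          = ∏ i with (i : Fin n).val < k, shiftDensity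
            (ξ i (Function.update y κ (ξ κ y + y κ)))
            (Function.update y κ (ξ κ y + y κ) i) := by
        intro y
        refine Finset.prod_congr rfl fun i hi => ?_
        have hi' : (i : ℕ) < k := by simpa using hi
        rw [hupd _ _ _ hi'.le, Function.update_of_ne]
        rintro rfl
        simp [hκ] at hi'
      rw [lintegral_congr fun y => congrArg
        (f (Function.update y κ (ξ κ y + y κ)) * ·) (h2 y),
        lintegral_pi_update_add κ (hξm κ) (fun y t => hupd y t κ (by simp [hκ]))
        (f := fun y => f y * ∏ i with (i : Fin n).val < k, shiftDensity (ξ i y) (y i))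
        (hf.mul (Finset.measurable_prod _ fun i _ => by fun_prop))]
      refine lintegral_congr fun y => ?_
      have : (Finset.univ.filter fun i : Fin n => (i : ℕ) < k + 1)
          = insert κ (Finset.univ.filter fun i : Fin n => (i : ℕ) < k) := by
        ext i
        have : i = κ ↔ (i : ℕ) = k := by rw [Fin.ext_iff, hκ]
        simp only [Finset.mem_filter, Finset.mem_univ, true_and, Finset.mem_insert, this]
        omega
      rw [this, Finset.prod_insert (by simp [hκ])]
      ring
  have := key n le_rfl f hf
  simpa using this

/-! ### Likelihood ratio of a code and the converse. -/

instance (n : ℕ) (α : ℝ≥0) : IsProbabilityMeasure (noise n α) := by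
  unfold noise; infer_instance

namespace Code

variable {M n : ℕ}

/-- The channel input as a function of the output sequence and the feedback noise. -/
noncomputable def causalInput (c : Code M n) (w : Fin M) (ω : (Fin n → ℝ) × (Fin n → ℝ))
    (i : Fin n) : ℝ :=
  c.enc i w fun j : Fin (i : ℕ) =>
    ω.1 ⟨j, j.isLt.trans i.isLt⟩ + ω.2 ⟨j, j.isLt.trans i.isLt⟩

lemma output_eq (c : Code M n) (w : Fin M) (ω : (Fin n → ℝ) × (Fin n → ℝ)) (i : Fin n) :
    c.output w ω i = c.causalInput w (c.output w ω, ω.2) i + ω.1 i := by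
  rw [output]; rfl

lemma input_eq (c : Code M n) (w : Fin M) (ω : (Fin n → ℝ) × (Fin n → ℝ)) (i : Fin n) :
    c.input w ω i = c.causalInput w (c.output w ω, ω.2) i := rfl

@[fun_prop]
lemma measurable_causalInput (c : Code M n) (w : Fin M) (i : Fin n) :
    Measurable fun ω => c.causalInput w ω i :=
  (c.measurable_enc i w).comp (by fun_prop)

@[fun_prop]
lemma measurable_output (c : Code M n) (w : Fin M) : Measurable (c.output w) := by
  refine measurable_pi_lambda _ fun i => ?_
  obtain ⟨i, hi⟩ := i
  induction i using Nat.strong_induction_on with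
  | _ i ih =>
    simp_rw [c.output_eq w _ ⟨i, hi⟩]
    refine Measurable.add ((c.measurable_enc _ w).comp (measurable_pi_lambda _ fun j => ?_))
      (by fun_prop)
    exact (ih j j.isLt _).add (by fun_prop)

/-- The likelihood ratio of the output given message `w` with respect to pure noise. -/
noncomputable def likelihood (c : Code M n) (w : Fin M) (ω : (Fin n → ℝ) × (Fin n → ℝ)) : ℝ≥0∞ :=
  ENNReal.ofReal (Real.exp (∑ i, c.causalInput w ω i * ω.1 i
    - (∑ i, c.causalInput w ω i ^ 2) / 2))

@[fun_prop]
lemma measurable_likelihood (c : Code M n) (w : Fin M) : Measurable (c.likelihood w) := by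
  unfold likelihood
  fun_prop

lemma prod_shiftDensity (c : Code M n) (w : Fin M) (ω : (Fin n → ℝ) × (Fin n → ℝ)) :
    ∏ i, shiftDensity (c.causalInput w ω i) (ω.1 i) = c.likelihood w ω := by
  unfold shiftDensity likelihood
  rw [← ENNReal.ofReal_prod_of_nonneg fun i _ => (Real.exp_pos _).le, ← Real.exp_sum,
    Finset.sum_sub_distrib, Finset.sum_div]

/-- For each fixed feedback noise the output is a causal shift of the forward noise. -/
lemma lintegral_output (c : Code M n) (w : Fin M) (α : ℝ≥0)
    {f : (Fin n → ℝ) × (Fin n → ℝ) → ℝ≥0∞} (hf : Measurable f) :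
    ∫⁻ ω, f (c.output w ω, ω.2) ∂(noise n α) = ∫⁻ ω, f ω * c.likelihood w ω ∂(noise n α) := by
  unfold noise
  rw [lintegral_prod_symm _ (by fun_prop), lintegral_prod_symm _ (by fun_prop)]
  refine lintegral_congr fun v => ?_
  simp_rw [← prod_shiftDensity]
  refine lintegral_pi_causal_shift (ξ := fun i y => c.causalInput w (y, v) i)
    (F := fun z => c.output w (z, v)) (f := fun y => f (y, v)) (fun i => by fun_prop) ?_
    (fun z i => c.output_eq w (z, v) i) (by fun_prop)
  intro i y y' h
  unfold causalInput
  congr 1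
  funext j
  simp only
  rw [h _ (by rw [Fin.lt_def]; exact j.isLt)]

/-- The code whose inputs are `t` times those of `c`, as functions of the feedback. -/
noncomputable def scale (c : Code M n) (t : ℝ) : Code M n where
  enc i w h := t * c.enc i w h
  measurable_enc i w := (c.measurable_enc i w).const_mul t
  dec := c.dec
  measurable_dec := c.measurable_dec

lemma likelihood_scale (c : Code M n) (t : ℝ) (w : Fin M) (ω : (Fin n → ℝ) × (Fin n → ℝ)) :
    (c.scale t).likelihood w ω = ENNReal.ofReal (Real.exp
      (t * ∑ i, c.causalInput w ω i * ω.1 i - t ^ 2 * (∑ i, c.causalInput w ω i ^ 2) / 2)) := by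
  have : ∀ i, (c.scale t).causalInput w ω i = t * c.causalInput w ω i := fun i => rfl
  unfold likelihood
  simp only [this, mul_pow, mul_assoc, Finset.mul_sum]

/-- Applied to `scale`, this gives the exponential moments needed for a Chernoff bound on ∑ x y. -/
lemma lintegral_likelihood (c : Code M n) (w : Fin M) (α : ℝ≥0) :
    ∫⁻ ω, c.likelihood w ω ∂(noise n α) = 1 := by
  have := c.lintegral_output w α (f := fun _ => 1) measurable_const
  simpa using this.symm

/-- The likelihood never vanishes, so an event that is null under the channel law is null under pure
noise. -/
lemma PeakEnergy.ae_causalInput {c : Code M n} {P : ℝ} {α : ℝ≥0} (hc : c.PeakEnergy P α)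
    (w : Fin M) : ∀ᵐ ω ∂(noise n α), ∑ i, c.causalInput w ω i ^ 2 ≤ n * P := by
  have hA : MeasurableSet {ω | ¬ ∑ i, c.causalInput w ω i ^ 2 ≤ n * P} :=
    by
    have : MeasurableSet {ω | ∑ i, c.causalInput w ω i ^ 2 ≤ n * P} :=
      measurableSet_le (by fun_prop) measurable_const
    exact this.compl
  have h0 : ∫⁻ ω, ({ω | ¬ ∑ i, c.causalInput w ω i ^ 2 ≤ n * P}.indicator 1 : _ → ℝ≥0∞)
      (c.output w ω, ω.2) ∂(noise n α) = 0 := by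
    rw [← lintegral_zero (μ := noise n α)]
    refine lintegral_congr_ae ?_
    filter_upwards [hc w] with ω hω
    simp only [input_eq] at hω
    simpa using hω
  rw [c.lintegral_output w α (measurable_one.indicator hA),
    lintegral_eq_zero_iff (by
      exact (measurable_one.indicator hA).mul (c.measurable_likelihood w))] at h0
  filter_upwards [h0] with ω hω
  by_contra hcon
  have : n * P < ∑ i, c.causalInput w ω i ^ 2 → c.likelihood w ω = 0 := by
    simpa [Set.indicator] using hω
  exact absurd (this (not_le.mp hcon)) (by simp [likelihood, Real.exp_pos])

/-- Chernoff bound at `t = -(ε / P)`, the minimizer of tεn + t²nP/2; the energy constraint controls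
the quadratic term. -/
lemma PeakEnergy.measure_correlation_le {c : Code M n} {P ε : ℝ} (hP : 0 < P) (hε : 0 < ε)
    {α : ℝ≥0} (hc : c.PeakEnergy P α) (w : Fin M) :
    noise n α {ω | ∑ i, c.causalInput w ω i * ω.1 i < -(ε * n)}
      ≤ ENNReal.ofReal (Real.exp (-(ε ^ 2 / (2 * P) * n))) := by
  set a : ℝ := ε ^ 2 / (2 * P) * n with ha
  have h1 : noise n α {ω | ∑ i, c.causalInput w ω i * ω.1 i < -(ε * n)}
      ≤ noise n α {ω | ENNReal.ofReal (Real.exp a) ≤ (c.scale (-(ε / P))).likelihood w ω} := by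
    refine measure_mono_ae ?_
    filter_upwards [hc.ae_causalInput w] with ω hω hω'
    have hω' : ∑ i, c.causalInput w ω i * ω.1 i < -(ε * n) := hω'
    change _ ≤ (c.scale (-(ε / P))).likelihood w ω
    rw [likelihood_scale]
    refine ENNReal.ofReal_le_ofReal (Real.exp_le_exp.mpr ?_)
    have e1 : (ε / P) * (ε * n) ≤ -(ε / P) * ∑ i, c.causalInput w ω i * ω.1 i := by
      have : 0 < ε / P := by positivity
      nlinarith
    have e2 : (-(ε / P)) ^ 2 * (∑ i, c.causalInput w ω i ^ 2) ≤ (-(ε / P)) ^ 2 * (n * P) :=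
      mul_le_mul_of_nonneg_left hω (sq_nonneg _)
    have e3 : a = (ε / P) * (ε * n) - (-(ε / P)) ^ 2 * (n * P) / 2 := by
      rw [ha]; field_simp; ring
    linarith
  have h2 := mul_meas_ge_le_lintegral (μ := noise n α)
    ((c.scale (-(ε / P))).measurable_likelihood w) (ENNReal.ofReal (Real.exp a))
  rw [lintegral_likelihood] at h2
  refine h1.trans ?_
  rw [Real.exp_neg, ENNReal.ofReal_inv_of_pos (Real.exp_pos _), ENNReal.le_inv_iff_mul_le,
    mul_comm]
  exact h2

lemma PeakEnergy.le_measure_error {c : Code M n} {P ε : ℝ} (hP : 0 < P) (hε : 0 < ε)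
    {α : ℝ≥0} (hc : c.PeakEnergy P α) (w : Fin M) :
    ENNReal.ofReal (Real.exp (-((P / 2 + ε) * n))) * (noise n α {ω | c.dec ω.1 ≠ w}
      - ENNReal.ofReal (Real.exp (-(ε ^ 2 / (2 * P) * n))))
      ≤ noise n α {ω | c.dec (c.output w ω) ≠ w} := by
  have hdec : MeasurableSet {y | c.dec y ≠ w} :=
    (c.measurable_dec (measurableSet_singleton w)).compl
  have hA : MeasurableSet {ω : (Fin n → ℝ) × (Fin n → ℝ) | c.dec ω.1 ≠ w} := measurable_fst hdec
  set A := {ω : (Fin n → ℝ) × (Fin n → ℝ) | c.dec ω.1 ≠ w}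
  set B := {ω : (Fin n → ℝ) × (Fin n → ℝ) | ∑ i, c.causalInput w ω i * ω.1 i < -(ε * n)}
  have hB : MeasurableSet B := measurableSet_lt (by fun_prop) measurable_const
  have h1 : noise n α {ω | c.dec (c.output w ω) ≠ w}
      = ∫⁻ ω, A.indicator 1 ω * c.likelihood w ω ∂(noise n α) := by
    rw [← c.lintegral_output w α (measurable_one.indicator hA),
      ← lintegral_indicator_one (s := {ω | c.dec (c.output w ω) ≠ w}) (c.measurable_output w hdec)]
    rfl
  rw [h1]
  calc _ ≤ ENNReal.ofReal (Real.exp (-((P / 2 + ε) * n))) * noise n α (A \ B) := by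
        gcongr
        exact (tsub_le_tsub_left (hc.measure_correlation_le hP hε w) _).trans le_measure_sdiff
    _ = ∫⁻ ω, (A \ B).indicator (fun _ => ENNReal.ofReal (Real.exp (-((P / 2 + ε) * n)))) ω
          ∂(noise n α) := by rw [lintegral_indicator_const (hA.diff hB)]
    _ ≤ _ := by
        refine lintegral_mono_ae ?_
        filter_upwards [hc.ae_causalInput w] with ω hω
        by_cases hAB : ω ∈ A \ B
        · have hb : -(ε * n) ≤ ∑ i, c.causalInput w ω i * ω.1 i := not_lt.mp hAB.2
          rw [Set.indicator_of_mem hAB, Set.indicator_of_mem hAB.1, Pi.one_apply, one_mul]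
          refine ENNReal.ofReal_le_ofReal (Real.exp_le_exp.mpr ?_)
          linarith
        · rw [Set.indicator_of_notMem hAB]
          exact zero_le

/-- Under pure noise the output does not depend on the message, and the decoder cannot name two
messages at once. -/
lemma exists_half_le_measure_dec_ne (hM : 2 ≤ M) (c : Code M n) (α : ℝ≥0) :
    ∃ w, (2⁻¹ : ℝ≥0∞) ≤ noise n α {ω | c.dec ω.1 ≠ w} := by
  by_contra! hcon
  have h0 := hcon ⟨0, by omega⟩
  have h1 := hcon ⟨1, by omega⟩
  have h2 : (1 : ℝ≥0∞) ≤ noise n α {ω | c.dec ω.1 ≠ ⟨0, by omega⟩}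
      + noise n α {ω | c.dec ω.1 ≠ ⟨1, by omega⟩} := by
    rw [← measure_univ (μ := noise n α)]
    refine (measure_mono fun ω _ => ?_).trans (measure_union_le _ _)
    by_cases h : c.dec ω.1 = ⟨0, by omega⟩
    · right; simp [h]
    · left; exact h
  have h3 := h2.trans_lt (ENNReal.add_lt_add h0 h1)
  rw [ENNReal.inv_two_add_inv_two] at h3
  exact lt_irrefl _ h3

end Code

/-! ### From error probabilities to exponents. -/

lemma tendsto_exp_neg_mul_nat {c : ℝ} (hc : 0 < c) :
    Tendsto (fun n : ℕ => Real.exp (-(c * n))) atTop (𝓝 0) :=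
  Real.tendsto_exp_neg_atTop_nhds_zero.comp
    (tendsto_natCast_atTop_atTop.const_mul_atTop hc)

lemma eventually_exp_le_bestErrorProb {M : ℕ} (hM : 2 ≤ M) {P : ℝ} (hP : 0 < P) {c₀ : ℝ}
    (hc₀ : P / 2 < c₀) (α : ℝ≥0) :
    ∀ᶠ n : ℕ in atTop, ENNReal.ofReal (Real.exp (-(c₀ * n))) ≤ bestErrorProb M n P α := by
  -- One `ε` pays for the correlation event, the other for the constant factor 1/(4M).
  obtain ⟨ε, hε, rfl⟩ : ∃ ε, 0 < ε ∧ c₀ = P / 2 + ε + ε := ⟨(c₀ - P / 2) / 2, by linarith, by ring⟩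
  have hM0 : (0 : ℝ) < M := by exact_mod_cast (by omega : 0 < M)
  have t1 := (tendsto_exp_neg_mul_nat (c := ε ^ 2 / (2 * P)) (by positivity)).eventually_le_const
    (show (0 : ℝ) < 1 / 4 by norm_num)
  have t2 := (tendsto_exp_neg_mul_nat hε).eventually_le_const
    (show (0 : ℝ) < (M : ℝ)⁻¹ * (1 / 4) by positivity)
  filter_upwards [t1, t2] with n h1 h2
  refine le_iInf₂ fun c hc => ?_
  obtain ⟨w, hw⟩ := c.exists_half_le_measure_dec_ne hM α
  have h3 := hc.le_measure_error hP hε w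
  have h4 : ENNReal.ofReal (1 / 4) ≤ noise n α {ω | c.dec ω.1 ≠ w}
      - ENNReal.ofReal (Real.exp (-(ε ^ 2 / (2 * P) * n))) := by
    refine le_trans ?_ (tsub_le_tsub hw (ENNReal.ofReal_le_ofReal h1))
    rw [show (2⁻¹ : ℝ≥0∞) = ENNReal.ofReal (1 / 2) by
      rw [one_div, ENNReal.ofReal_inv_of_pos (by norm_num)]; simp,
      ← ENNReal.ofReal_sub _ (by norm_num)]
    norm_num
  have h5 : noise n α {ω | c.dec (c.output w ω) ≠ w}
      ≤ ∑ w : Fin M, noise n α {ω | c.dec (c.output w ω) ≠ w} :=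
    Finset.single_le_sum (f := fun w : Fin M => noise n α {ω | c.dec (c.output w ω) ≠ w})
      (fun _ _ => zero_le) (Finset.mem_univ w)
  unfold Code.errorProb
  calc ENNReal.ofReal (Real.exp (-((P / 2 + ε + ε) * n)))
      = ENNReal.ofReal (Real.exp (-(ε * n))) * ENNReal.ofReal (Real.exp (-((P / 2 + ε) * n))) := by
        rw [← ENNReal.ofReal_mul (Real.exp_pos _).le, ← Real.exp_add]
        congr 2; ring
    _ ≤ ((M : ℝ≥0∞)⁻¹ * ENNReal.ofReal (1 / 4))
          * ENNReal.ofReal (Real.exp (-((P / 2 + ε) * n))) := by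
        gcongr
        refine (ENNReal.ofReal_le_ofReal h2).trans_eq ?_
        rw [ENNReal.ofReal_mul (by positivity), ENNReal.ofReal_inv_of_pos hM0,
          ENNReal.ofReal_natCast]
    _ = (M : ℝ≥0∞)⁻¹ * (ENNReal.ofReal (Real.exp (-((P / 2 + ε) * n)))
          * ENNReal.ofReal (1 / 4)) := by ring
    _ ≤ _ := by
        gcongr
        exact (mul_le_mul_right h4 _).trans (h3.trans h5)

lemma neg_inv_mul_log_le {n : ℕ} (hn : n ≠ 0) {c : ℝ} {p : ℝ≥0∞}
    (h : ENNReal.ofReal (Real.exp (-(c * n))) ≤ p) :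
    -(1 / (n : EReal)) * ENNReal.log p ≤ (c : EReal) := by
  have hn' : (n : ℝ) ≠ 0 := by exact_mod_cast hn
  have e : (1 / (n : EReal)) = ((1 / (n : ℝ) : ℝ) : EReal) := by
    rw [EReal.coe_div]; simp
  have h1 := ENNReal.log_le_log h
  rw [ENNReal.log_ofReal_of_pos (Real.exp_pos _), Real.log_exp] at h1
  rw [EReal.neg_mul, EReal.neg_le, e]
  refine le_trans (le_of_eq ?_)
    (mul_le_mul_of_nonneg_left h1 (by exact_mod_cast (by positivity : (0 : ℝ) ≤ 1 / n)))
  rw [← EReal.coe_mul, ← EReal.coe_neg]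
  congr 1
  field_simp

lemma le_neg_inv_mul_log {n : ℕ} (hn : n ≠ 0) {c : ℝ} {p : ℝ≥0∞}
    (h : p ≤ ENNReal.ofReal (Real.exp (-(c * n)))) :
    (c : EReal) ≤ -(1 / (n : EReal)) * ENNReal.log p := by
  have hn' : (n : ℝ) ≠ 0 := by exact_mod_cast hn
  have e : (1 / (n : EReal)) = ((1 / (n : ℝ) : ℝ) : EReal) := by
    rw [EReal.coe_div]; simp
  have h1 := ENNReal.log_le_log h
  rw [ENNReal.log_ofReal_of_pos (Real.exp_pos _), Real.log_exp] at h1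
  rw [EReal.neg_mul, EReal.le_neg, e]
  refine le_trans
    (mul_le_mul_of_nonneg_left h1 (by exact_mod_cast (by positivity : (0 : ℝ) ≤ 1 / n)))
    (le_of_eq ?_)
  rw [← EReal.coe_mul, ← EReal.coe_neg]
  congr 1
  field_simp

lemma errorExponent_le {M : ℕ} (hM : 2 ≤ M) {P : ℝ} (hP : 0 < P) (α : ℝ≥0) :
    errorExponent M P α ≤ ((P / 2 : ℝ) : EReal) := by
  refine EReal.le_of_forall_lt_iff_le.mp fun c hc => ?_
  refine limsup_le_of_le (by isBoundedDefault) ?_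
  filter_upwards [eventually_exp_le_bestErrorProb hM hP (EReal.coe_lt_coe_iff.mp hc) α,
    eventually_ne_atTop 0] with n h hn
  exact neg_inv_mul_log_le hn h

lemma le_errorExponent_of_eventually {M : ℕ} {P c : ℝ} {α : ℝ≥0}
    (h : ∀ᶠ n : ℕ in atTop, bestErrorProb M n P α ≤ ENNReal.ofReal (Real.exp (-(c * n)))) :
    (c : EReal) ≤ errorExponent M P α := by
  refine le_limsup_of_frequently_le (Eventually.frequently ?_) (by isBoundedDefault)
  filter_upwards [h, eventually_ne_atTop 0] with n h hn
  exact le_neg_inv_mul_log hn h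

/-! ### Tails of sums of squared Gaussians. -/

lemma lintegral_exp_mul_sq_gaussianReal_lt_top {s : ℝ} (hs : s < 1 / 2) :
    ∫⁻ x, ENNReal.ofReal (Real.exp (s * x ^ 2)) ∂(gaussianReal 0 1) < ∞ := by
  rw [gaussianReal_of_var_ne_zero _ one_ne_zero,
    lintegral_withDensity_eq_lintegral_mul _ (measurable_gaussianPDF _ _) (by fun_prop)]
  have h : ∀ x : ℝ, (gaussianPDF 0 1 * fun x => ENNReal.ofReal (Real.exp (s * x ^ 2))) x
      = ENNReal.ofReal ((√(2 * Real.pi))⁻¹ * Real.exp (-(1 / 2 - s) * x ^ 2)) := by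
    intro x
    rw [Pi.mul_apply, gaussianPDF, ← ENNReal.ofReal_mul (gaussianPDFReal_nonneg _ _ _),
      gaussianPDFReal, mul_assoc, ← Real.exp_add]
    congr 3
    · simp
    · simp; ring
  simp_rw [h]
  exact ((integrable_exp_neg_mul_sq (by linarith)).const_mul _).lintegral_lt_top

/-- `N(0, α)` is the law of √α times a standard normal variable, also for `α = 0`; so one constant
serves all small `α`. -/
lemma lintegral_exp_mul_sq_gaussianReal_le {c s : ℝ} {α : ℝ≥0} (h : c * α ≤ s) :
    ∫⁻ x, ENNReal.ofReal (Real.exp (c * x ^ 2)) ∂(gaussianReal 0 α)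
      ≤ ∫⁻ x, ENNReal.ofReal (Real.exp (s * x ^ 2)) ∂(gaussianReal 0 1) := by
  have h1 : gaussianReal 0 α = (gaussianReal 0 1).map (√(α : ℝ) * ·) := by
    rw [gaussianReal_map_const_mul]
    congr 1
    · simp
    · ext; simp
  rw [h1, lintegral_map (by fun_prop) (by fun_prop)]
  refine lintegral_mono fun x => ENNReal.ofReal_le_ofReal (Real.exp_le_exp.mpr ?_)
  rw [mul_pow, Real.sq_sqrt (NNReal.coe_nonneg α), ← mul_assoc]
  exact mul_le_mul_of_nonneg_right h (sq_nonneg x)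

/-- Chernoff bound. It is applied to at most `k` coordinates with `k` fixed, so the prefactor does
not affect the exponent. -/
lemma measure_pi_sum_sq_gt_le {n : ℕ} (s : Finset (Fin n)) (ν : Measure ℝ)
    [IsProbabilityMeasure ν] {c : ℝ} (hc : 0 ≤ c) (t : ℝ) {K : ℝ≥0∞}
    (hK : ∫⁻ x, ENNReal.ofReal (Real.exp (c * x ^ 2)) ∂ν ≤ K) :
    (Measure.pi fun _ : Fin n => ν) {z | t < ∑ i ∈ s, z i ^ 2}
      ≤ K ^ s.card * ENNReal.ofReal (Real.exp (-(c * t))) := by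
  have h1 : ∫⁻ z, ∏ i ∈ s, ENNReal.ofReal (Real.exp (c * z i ^ 2)) ∂(Measure.pi fun _ : Fin n => ν)
      ≤ K ^ s.card := by
    have hind : iIndepFun (fun i (z : Fin n → ℝ) => ENNReal.ofReal (Real.exp (c * z i ^ 2)))
        (Measure.pi fun _ : Fin n => ν) :=
      iIndepFun_pi (μ := fun _ : Fin n => ν)
        (X := fun (_ : Fin n) (x : ℝ) => ENNReal.ofReal (Real.exp (c * x ^ 2)))
        fun _ => Measurable.aemeasurable (by fun_prop)
    rw [lintegral_prod_eq_prod_lintegral_of_indepFun s _ hind (fun i => by fun_prop)]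
    refine Finset.prod_le_pow_card _ _ _ fun i _ => ?_
    refine le_trans (le_of_eq ?_) hK
    exact (measurePreserving_eval (fun _ : Fin n => ν) i).lintegral_comp
      (f := fun x => ENNReal.ofReal (Real.exp (c * x ^ 2))) (by fun_prop)
  have h2 := mul_meas_ge_le_lintegral (μ := Measure.pi fun _ : Fin n => ν)
    (f := fun z => ∏ i ∈ s, ENNReal.ofReal (Real.exp (c * z i ^ 2)))
    (Finset.measurable_prod _ fun i _ => by fun_prop) (ENNReal.ofReal (Real.exp (c * t)))
  have h3 : {z : Fin n → ℝ | t < ∑ i ∈ s, z i ^ 2} ⊆ {z | ENNReal.ofReal (Real.exp (c * t))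
      ≤ ∏ i ∈ s, ENNReal.ofReal (Real.exp (c * z i ^ 2))} := by
    intro z (hz : t < ∑ i ∈ s, z i ^ 2)
    change ENNReal.ofReal (Real.exp (c * t)) ≤ ∏ i ∈ s, ENNReal.ofReal (Real.exp (c * z i ^ 2))
    rw [← ENNReal.ofReal_prod_of_nonneg fun i _ => (Real.exp_pos _).le, ← Real.exp_sum,
      ← Finset.mul_sum]
    exact ENNReal.ofReal_le_ofReal (Real.exp_le_exp.mpr (mul_le_mul_of_nonneg_left hz.le hc))
  refine (measure_mono h3).trans ?_
  rw [Real.exp_neg, ENNReal.ofReal_inv_of_pos (Real.exp_pos _), ← div_eq_mul_inv,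
    ENNReal.le_div_iff_mul_le (by simp [Real.exp_pos]) (by simp), mul_comm]
  exact h2.trans h1

/-! ### The linear feedback scheme and its decoder. -/

/-- Extension of a finite sequence by zero. -/
def extendZero {n : ℕ} (y : Fin n → ℝ) (j : ℕ) : ℝ := if h : j < n then y ⟨j, h⟩ else 0

lemma extendZero_of_lt {n : ℕ} (y : Fin n → ℝ) {j : ℕ} (h : j < n) :
    extendZero y j = y ⟨j, h⟩ := dif_pos h

@[fun_prop]
lemma measurable_extendZero {n : ℕ} (j : ℕ) :
    Measurable fun y : Fin n → ℝ => extendZero y j := by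
  unfold extendZero
  split_ifs <;> fun_prop

lemma sum_range_extendZero_sq {n k : ℕ} (hk : k ≤ n) (y : Fin n → ℝ) :
    ∑ j ∈ Finset.range k, extendZero y j ^ 2
      = ∑ i with (i : Fin n).val < k, y i ^ 2 := by
  have h1 : ∀ i : Fin n, y i = extendZero y i := fun i => (extendZero_of_lt y i.isLt).symm
  simp_rw [h1]
  rw [Finset.sum_filter,
    Fin.sum_univ_eq_sum_range (fun j => if j < k then extendZero y j ^ 2 else 0) n,
    ← Finset.sum_filter]
  congr 1
  ext j
  simp
  omega

/-- The input of the linear feedback scheme started from `θ`: at each step the transmitter sends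
`-b` times the noise of the previous step, as it sees it through the feedback `y`. -/
def linearInput (b θ : ℝ) (y : ℕ → ℝ) : ℕ → ℝ
  | 0 => θ
  | i + 1 => b * (linearInput b θ y i - y i)

lemma linearInput_congr {b θ : ℝ} {y y' : ℕ → ℝ} {i : ℕ} (h : ∀ j < i, y j = y' j) :
    linearInput b θ y i = linearInput b θ y' i := by
  induction i with
  | zero => rfl
  | succ i ih =>
    rw [linearInput, linearInput, ih fun j hj => h j (by omega), h i (by omega)]

@[fun_prop]
lemma measurable_linearInput {Ω : Type*} [MeasurableSpace Ω] (b θ : ℝ) {y : Ω → ℕ → ℝ}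
    (hy : ∀ j, Measurable fun ω => y ω j) (i : ℕ) :
    Measurable fun ω => linearInput b θ (y ω) i := by
  induction i with
  | zero => exact measurable_const
  | succ i ih => exact (ih.sub (hy i)).const_mul b

/-- The recursion reads y j = x j - b⁻¹ x (j+1), so the weighted sum telescopes. -/
lemma sum_inv_pow_mul {b : ℝ} (hb : b ≠ 0) (θ : ℝ) (y : ℕ → ℝ) (m : ℕ) :
    ∑ j ∈ Finset.range m, b⁻¹ ^ j * y j = θ - b⁻¹ ^ m * linearInput b θ y m := by
  induction m with
  | zero => simp [linearInput]
  | succ m ih =>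
    rw [Finset.sum_range_succ, ih, linearInput, pow_succ]
    field_simp
    ring

/-- The linear scheme, stopped after `k` channel uses or when its energy would exceed `E`. -/
noncomputable def clippedInput (E : ℝ) (k : ℕ) (b θ : ℝ) (y : ℕ → ℝ) (i : ℕ) : ℝ :=
  if i < k ∧ ∑ j ∈ Finset.range (i + 1), linearInput b θ y j ^ 2 ≤ E then linearInput b θ y i else 0

/-- The energy test at time `i` includes the input of time `i`, which still depends only on earlier
feedback. -/
lemma clippedInput_congr {E b θ : ℝ} {k : ℕ} {y y' : ℕ → ℝ} {i : ℕ} (h : ∀ j < i, y j = y' j) :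
    clippedInput E k b θ y i = clippedInput E k b θ y' i := by
  have : ∀ j ∈ Finset.range (i + 1), linearInput b θ y j ^ 2 = linearInput b θ y' j ^ 2 := by
    intro j hj
    rw [linearInput_congr fun l hl => h l (by simp at hj; omega)]
  rw [clippedInput, clippedInput, linearInput_congr h, Finset.sum_congr rfl this]

lemma measurable_clippedInput {Ω : Type*} [MeasurableSpace Ω] (E b θ : ℝ) (k : ℕ) {y : Ω → ℕ → ℝ}
    (hy : ∀ j, Measurable fun ω => y ω j) (i : ℕ) :
    Measurable fun ω => clippedInput E k b θ (y ω) i := by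
  unfold clippedInput
  refine Measurable.ite ?_ (by fun_prop) measurable_const
  have h : MeasurableSet {ω | ∑ j ∈ Finset.range (i + 1), linearInput b θ (y ω) j ^ 2 ≤ E} :=
    measurableSet_le (Finset.measurable_sum _ fun j _ => by fun_prop) measurable_const
  exact (MeasurableSet.const (i < k)).inter h

lemma sum_clippedInput_sq_le {E : ℝ} (hE : 0 ≤ E) (k : ℕ) (b θ : ℝ) (y : ℕ → ℝ) (n : ℕ) :
    ∑ i ∈ Finset.range n, clippedInput E k b θ y i ^ 2 ≤ E := by
  induction n with
  | zero => simpa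
  | succ n ih =>
    by_cases h : ∑ j ∈ Finset.range (n + 1), linearInput b θ y j ^ 2 ≤ E
    · refine le_trans (Finset.sum_le_sum fun i _ => ?_) h
      unfold clippedInput
      split_ifs
      · exact le_rfl
      · simpa using sq_nonneg _
    · rw [Finset.sum_range_succ, clippedInput, if_neg fun h' => h h'.2]
      simpa using ih

/-- The code which runs the clipped linear scheme from the points `w * d` and decodes to the
point nearest to the linear estimate. -/
noncomputable def linearCode {M : ℕ} (hM : 0 < M) (n k : ℕ) (E b d : ℝ) : Code M n where
  enc i w h := clippedInput E k b (w * d) (extendZero h) i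
  measurable_enc i w := measurable_clippedInput _ _ _ _ (fun j => measurable_extendZero j) _
  dec y := ⟨min ⌊(∑ j ∈ Finset.range k, b⁻¹ ^ j * extendZero y j) / d + 1 / 2⌋₊ (M - 1), by omega⟩
  measurable_dec := by
    have h : Measurable fun m : ℕ => (⟨min m (M - 1), by omega⟩ : Fin M) := measurable_from_top
    refine h.comp (Nat.measurable_floor.comp ?_)
    exact ((Finset.measurable_sum _ fun j _ => by fun_prop).div_const d).add_const _

section LinearCode

variable {M : ℕ} (hM : 0 < M) {n k : ℕ} {E b d : ℝ}

lemma input_linearCode (w : Fin M) (ω : (Fin n → ℝ) × (Fin n → ℝ)) (i : Fin n) :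
    (linearCode hM n k E b d).input w ω i
      = clippedInput E k b (w * d) (extendZero ((linearCode hM n k E b d).feedback w ω)) i := by
  refine clippedInput_congr fun j hj => ?_
  rw [extendZero_of_lt _ hj, extendZero_of_lt _ (hj.trans i.isLt)]

lemma feedback_eq {n : ℕ} (c : Code M n) (w : Fin M) (ω : (Fin n → ℝ) × (Fin n → ℝ)) (i : Fin n) :
    c.feedback w ω i = c.input w ω i + (ω.1 i + ω.2 i) := by
  rw [Code.feedback, c.output_eq, c.input_eq]
  ring

lemma peakEnergy_linearCode {P : ℝ} (hP : 0 ≤ P) (α : ℝ≥0) :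
    (linearCode hM n k (n * P) b d).PeakEnergy P α := by
  refine fun w => ae_of_all _ fun ω => ?_
  simp_rw [input_linearCode]
  rw [Fin.sum_univ_eq_sum_range (fun i => clippedInput (n * P) k b (w * d)
    (extendZero ((linearCode hM n k (n * P) b d).feedback w ω)) i ^ 2) n]
  exact sum_clippedInput_sq_le (by positivity) _ _ _ _ _

/-- As long as the energy of the fed back noise is small, clipping does not take place. -/
lemma linearInput_feedback (hk : k ≤ n) (w : Fin M) (ω : (Fin n → ℝ) × (Fin n → ℝ))
    (hE : (w * d) ^ 2 + b ^ 2 * ∑ j ∈ Finset.range k,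
      (extendZero ω.1 j + extendZero ω.2 j) ^ 2 ≤ E) {i : ℕ} (hi : i < k) :
    extendZero ((linearCode hM n k E b d).feedback w ω) i
      = linearInput b (w * d) (extendZero ((linearCode hM n k E b d).feedback w ω)) i
        + (extendZero ω.1 i + extendZero ω.2 i) := by
  set Y := extendZero ((linearCode hM n k E b d).feedback w ω) with hY
  induction i using Nat.strong_induction_on with
  | _ i ih =>
    have hin : i < n := hi.trans_le hk
    have h1 : Y i = clippedInput E k b (w * d) Y i + (extendZero ω.1 i + extendZero ω.2 i) := by
      rw [hY, extendZero_of_lt _ hin, feedback_eq, input_linearCode, extendZero_of_lt _ hin,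
        extendZero_of_lt _ hin]
    rw [h1, clippedInput, if_pos]
    refine ⟨hi, le_trans ?_ hE⟩
    -- The initial input is split off; by induction each later one is `-b` times a fed back noise.
    rw [Finset.sum_range_succ', add_comm, Finset.mul_sum]
    refine add_le_add le_rfl ?_
    calc ∑ j ∈ Finset.range i, linearInput b (w * d) Y (j + 1) ^ 2
        = ∑ j ∈ Finset.range i, b ^ 2 * (extendZero ω.1 j + extendZero ω.2 j) ^ 2 := by
          refine Finset.sum_congr rfl fun j hj => ?_
          have hj' : j < i := Finset.mem_range.mp hj
          rw [linearInput, ih j hj' (hj'.trans hi)]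
          ring
      _ ≤ _ := Finset.sum_le_sum_of_subset_of_nonneg
          (Finset.range_subset_range.mpr hi.le) fun _ _ _ => by positivity

/-- The linear estimate misses `w * d` by two terms, each below a quarter of the spacing `d`, so
rounding recovers `w`. -/
lemma dec_linearCode_eq (hb : 1 ≤ b) (hd : 0 < d) (hk : k ≤ n) (w : Fin M)
    (ω : (Fin n → ℝ) × (Fin n → ℝ))
    (hE : (w * d) ^ 2 + b ^ 2 * ∑ j ∈ Finset.range k,
      (extendZero ω.1 j + extendZero ω.2 j) ^ 2 ≤ E)
    (hbk : b⁻¹ ^ k * √E < d / 4)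
    (hv : √(k * ∑ j ∈ Finset.range k, extendZero ω.2 j ^ 2) < d / 4) :
    (linearCode hM n k E b d).dec ((linearCode hM n k E b d).output w ω) = w := by
  have hb0 : 0 < b := by linarith
  have hbi : b⁻¹ ≤ 1 := inv_le_one_of_one_le₀ hb
  have hbi0 : 0 < b⁻¹ := inv_pos.mpr hb0
  set Y := extendZero ((linearCode hM n k E b d).feedback w ω) with hY
  have hrec : ∀ i < k, linearInput b (w * d) Y (i + 1)
      = -b * (extendZero ω.1 i + extendZero ω.2 i) := by
    intro i hi
    rw [linearInput]
    have := linearInput_feedback hM hk w ω hE hi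
    rw [← hY] at this
    rw [this]
    ring
  -- The input that would come next is `w * d` if `k = 0` and otherwise `-b` times the last noise;
  -- the budget in `hE` covers both.
  have hu : |linearInput b (w * d) Y k| ≤ √E := by
    refine Real.abs_le_sqrt (le_trans ?_ hE)
    have hnn : ∀ m, 0 ≤ b ^ 2 * ∑ j ∈ Finset.range m,
        (extendZero ω.1 j + extendZero ω.2 j) ^ 2 := fun m => by positivity
    rcases k with _ | m
    · have := hnn 0
      simp [linearInput]
    · rw [hrec m (by omega), Finset.sum_range_succ]
      have := hnn m
      nlinarith [sq_nonneg ((w : ℝ) * d)]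
  have hsum : ∑ j ∈ Finset.range k,
      b⁻¹ ^ j * extendZero ((linearCode hM n k E b d).output w ω) j
      = w * d - b⁻¹ ^ k * linearInput b (w * d) Y k
        - ∑ j ∈ Finset.range k, b⁻¹ ^ j * extendZero ω.2 j := by
    rw [← sum_inv_pow_mul hb0.ne', ← Finset.sum_sub_distrib]
    refine Finset.sum_congr rfl fun j hj => ?_
    have hjn : j < n := (Finset.mem_range.mp hj).trans_le hk
    rw [hY, extendZero_of_lt _ hjn, extendZero_of_lt _ hjn, extendZero_of_lt _ hjn, Code.feedback]
    ring
  have h1 : |b⁻¹ ^ k * linearInput b (w * d) Y k| < d / 4 := by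
    rw [abs_mul, abs_of_pos (by positivity)]
    exact (mul_le_mul_of_nonneg_left hu (by positivity)).trans_lt hbk
  -- Cauchy–Schwarz, with all weights at most 1.
  have h2 : |∑ j ∈ Finset.range k, b⁻¹ ^ j * extendZero ω.2 j| < d / 4 := by
    refine lt_of_le_of_lt (Real.abs_le_sqrt ?_) hv
    have hcs := Finset.sum_mul_sq_le_sq_mul_sq (Finset.range k) (fun j => b⁻¹ ^ j)
      (fun j => extendZero ω.2 j)
    refine hcs.trans (mul_le_mul_of_nonneg_right ?_ (Finset.sum_nonneg fun _ _ => sq_nonneg _))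
    calc ∑ j ∈ Finset.range k, (b⁻¹ ^ j) ^ 2 ≤ ∑ j ∈ Finset.range k, (1 : ℝ) :=
          Finset.sum_le_sum fun j _ =>
            pow_le_one₀ (by positivity) (pow_le_one₀ hbi0.le hbi)
      _ = k := by simp
  have h3 : ⌊(∑ j ∈ Finset.range k,
      b⁻¹ ^ j * extendZero ((linearCode hM n k E b d).output w ω) j) / d + 1 / 2⌋₊ = (w : ℕ) := by
    rw [hsum]
    rw [abs_lt] at h1 h2
    have hw : (w * d - b⁻¹ ^ k * linearInput b (w * d) Y k
        - ∑ j ∈ Finset.range k, b⁻¹ ^ j * extendZero ω.2 j) / d + 1 / 2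
        = w + (1 / 2 - (b⁻¹ ^ k * linearInput b (w * d) Y k
          + ∑ j ∈ Finset.range k, b⁻¹ ^ j * extendZero ω.2 j) / d) := by
      field_simp
      ring
    have h4 : (b⁻¹ ^ k * linearInput b (w * d) Y k
          + ∑ j ∈ Finset.range k, b⁻¹ ^ j * extendZero ω.2 j) / d < 1 / 2 := by
      rw [div_lt_iff₀ hd]; linarith
    have h5 : -(1 / 2) < (b⁻¹ ^ k * linearInput b (w * d) Y k
          + ∑ j ∈ Finset.range k, b⁻¹ ^ j * extendZero ω.2 j) / d := by
      rw [lt_div_iff₀ hd]; linarith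
    have hw0 : (0 : ℝ) ≤ (w : ℕ) := Nat.cast_nonneg _
    rw [hw, Nat.floor_eq_iff (by linarith)]
    constructor <;> linarith
  ext
  change min ⌊_⌋₊ (M - 1) = (w : ℕ)
  rw [h3]
  have := w.isLt
  omega

end LinearCode

/-! ### Choice of parameters and the exponent of the scheme. -/

/-- Parameters of the linear scheme: gain `b`, number `k` of channel uses, initial energy `l`
(relative to `P`) and the allowed energy `q` of the feedback noise. -/
lemma exists_linear_scheme_parameters {M : ℕ} (hM : 0 < M) {P κ : ℝ} (hP : 0 < P) (hκ0 : 0 < κ)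
    (hκ : κ < 1) :
    ∃ (k : ℕ) (b l q : ℝ), 1 ≤ b ∧ 0 < l ∧ 0 < q ∧
      (∀ x y : ℝ, 0 ≤ x → x ≤ κ * P → 0 ≤ y → y ≤ q → ∀ s : ℝ, s ≤ (1 + l) * x + (1 + l⁻¹) * y →
        l * P + b ^ 2 * s ≤ P) ∧
      b⁻¹ ^ k * (4 * M) < √l ∧ 16 * M ^ 2 * k * q < l * P := by
  have hM' : (0 : ℝ) < M := by exact_mod_cast hM
  -- With κ = 1 - 6l and b² = 1 + l, the energy total l + (1+l)((1+l)κ + l) equals 1 - 2l - 10l² -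
  -- 6l³.
  obtain ⟨l, hl, hl6⟩ : ∃ l, 0 < l ∧ 6 * l = 1 - κ := ⟨(1 - κ) / 6, by linarith, by ring⟩
  set b := √(1 + l) with hb
  have hb1 : 1 < b := by
    rw [hb, Real.lt_sqrt (by norm_num)]; linarith
  have hb2 : b ^ 2 = 1 + l := Real.sq_sqrt (by linarith)
  obtain ⟨k, hk⟩ := exists_pow_lt_of_lt_one (show 0 < √l / (4 * M) by positivity)
    (inv_lt_one_of_one_lt₀ hb1)
  -- The first term limits what feedback noise adds to the energy, the second its effect on the
  -- estimate; `k + 1` keeps the denominator positive and the last inequality strict.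
  set q := min (l ^ 2 * P / (1 + l)) (l * P / (16 * M ^ 2 * (k + 1))) with hq
  have hq0 : 0 < q := lt_min (by positivity) (by positivity)
  refine ⟨k, b, l, q, hb1.le, hl, hq0, ?_, ?_, ?_⟩
  · intro x y hx hx' hy hy' s hs
    have h1 : (1 + l⁻¹) * y ≤ l * P := by
      have : y ≤ l ^ 2 * P / (1 + l) := hy'.trans (min_le_left _ _)
      calc (1 + l⁻¹) * y ≤ (1 + l⁻¹) * (l ^ 2 * P / (1 + l)) := by gcongr
        _ = l * P := by field_simp; ring
    have h2 : (1 + l) * x ≤ (1 + l) * (κ * P) := by gcongr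
    have h3 : (1 + l) * s ≤ (1 + l) * ((1 + l) * (κ * P) + l * P) := by
      gcongr; linarith
    rw [hb2]
    have h4 : l + (1 + l) * ((1 + l) * κ + l) ≤ 1 := by
      have : l < 1 / 6 := by linarith
      have e : κ = 1 - 6 * l := by linarith
      rw [e]
      nlinarith [mul_pos hl hl, mul_pos (mul_pos hl hl) hl]
    have h5 := mul_le_mul_of_nonneg_right h4 hP.le
    linarith
  · rwa [lt_div_iff₀ (by positivity)] at hk
  · have h1 : q ≤ l * P / (16 * M ^ 2 * (k + 1)) := min_le_right _ _
    rw [le_div_iff₀ (by positivity)] at h1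
    have : 0 < 16 * (M : ℝ) ^ 2 * q := by positivity
    linarith

/-- Young's inequality, weighted so that the forward noise, which determines the exponent, loses
only the factor `1 + l`. -/
lemma sum_add_sq_le {l : ℝ} (hl : 0 < l) (s : Finset ℕ) (x y : ℕ → ℝ) :
    ∑ j ∈ s, (x j + y j) ^ 2 ≤ (1 + l) * ∑ j ∈ s, x j ^ 2 + (1 + l⁻¹) * ∑ j ∈ s, y j ^ 2 := by
  rw [Finset.mul_sum, Finset.mul_sum, ← Finset.sum_add_distrib]
  refine Finset.sum_le_sum fun j _ => ?_
  have h : 0 ≤ l⁻¹ * (l * x j - y j) ^ 2 := by positivity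
  have e : l⁻¹ * (l * x j - y j) ^ 2 = l * x j ^ 2 - 2 * (x j * y j) + l⁻¹ * y j ^ 2 := by
    field_simp
    ring
  linarith

lemma exists_code_errorProb_le {M : ℕ} (hM : 0 < M) {P κ : ℝ} (hP : 0 < P) (hκ0 : 0 < κ)
    (hκ : κ < 1) : ∃ (k : ℕ) (q : ℝ), 0 < q ∧ ∀ n : ℕ, k ≤ n → 0 < n → ∀ α : ℝ≥0,
      bestErrorProb M n P α ≤
        noise n α {ω | n * (κ * P) < ∑ i with (i : Fin n).val < k, ω.1 i ^ 2}
        + noise n α {ω | n * q < ∑ i with (i : Fin n).val < k, ω.2 i ^ 2} := by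
  obtain ⟨k, b, l, q, hb, hl, hq, hen, hbk, hkq⟩ := exists_linear_scheme_parameters hM hP hκ0 hκ
  refine ⟨k, q, hq, fun n hkn hn α => ?_⟩
  have hM' : (0 : ℝ) < M := by exact_mod_cast hM
  have hn' : (0 : ℝ) < n := by exact_mod_cast hn
  have hnP : 0 < n * P := by positivity
  -- This spacing keeps the energy of every starting point within l·nP.
  set d := √(l * (n * P)) / M with hd
  have hd0 : 0 < d := by positivity
  have hd2 : (M * d) ^ 2 = l * (n * P) := by
    rw [hd, mul_div_cancel₀ _ hM'.ne', Real.sq_sqrt (by positivity)]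
  refine (iInf₂_le (linearCode hM n k (n * P) b d) (peakEnergy_linearCode hM hP.le α)).trans ?_
  set B := noise n α {ω | n * (κ * P) < ∑ i with (i : Fin n).val < k, ω.1 i ^ 2}
    + noise n α {ω | n * q < ∑ i with (i : Fin n).val < k, ω.2 i ^ 2} with hB
  have key : ∀ w, noise n α {ω | (linearCode hM n k (n * P) b d).dec
      ((linearCode hM n k (n * P) b d).output w ω) ≠ w} ≤ B := by
    intro w
    refine (measure_mono fun ω hω => ?_).trans (measure_union_le _ _)
    by_contra hcon
    simp only [Set.mem_union, not_or] at hcon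
    obtain ⟨h1, h2⟩ := hcon
    have h1 : ∑ i with (i : Fin n).val < k, ω.1 i ^ 2 ≤ n * (κ * P) := not_lt.mp h1
    have h2 : ∑ i with (i : Fin n).val < k, ω.2 i ^ 2 ≤ n * q := not_lt.mp h2
    rw [← sum_range_extendZero_sq hkn] at h1 h2
    refine hω (dec_linearCode_eq hM hb hd0 hkn w ω ?_ ?_ ?_)
    · have h3 := sum_add_sq_le hl (Finset.range k) (extendZero ω.1) (extendZero ω.2)
      have hw : ((w : ℕ) * d) ^ 2 ≤ (M * d) ^ 2 := by
        have : ((w : ℕ) : ℝ) ≤ M := by exact_mod_cast w.isLt.le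
        gcongr
      set X := ∑ j ∈ Finset.range k, extendZero ω.1 j ^ 2
      set V := ∑ j ∈ Finset.range k, extendZero ω.2 j ^ 2
      set S := ∑ j ∈ Finset.range k, (extendZero ω.1 j + extendZero ω.2 j) ^ 2
      have hX : 0 ≤ X := Finset.sum_nonneg fun _ _ => sq_nonneg _
      have hV : 0 ≤ V := Finset.sum_nonneg fun _ _ => sq_nonneg _
      have h4 := hen (X / n) (V / n) (by positivity) (by rw [div_le_iff₀ hn']; linarith)
        (by positivity) (by rw [div_le_iff₀ hn']; linarith) (S / n) (by
          rw [← mul_div_assoc, ← mul_div_assoc, ← add_div]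
          gcongr)
      have h5 := mul_le_mul_of_nonneg_left h4 hn'.le
      have h6 : n * (l * P + b ^ 2 * (S / n)) = l * (n * P) + b ^ 2 * S := by
        field_simp
      linarith
    · have : d / 4 = √l / (4 * M) * √(n * P) := by
        rw [hd, Real.sqrt_mul hl.le]; field_simp
      rw [this]
      refine mul_lt_mul_of_pos_right ?_ (Real.sqrt_pos.mpr hnP)
      rwa [lt_div_iff₀ (by positivity)]
    · rw [Real.sqrt_lt' (by positivity)]
      have h3 : (k : ℝ) * ∑ j ∈ Finset.range k, extendZero ω.2 j ^ 2 ≤ k * (n * q) := by gcongr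
      refine h3.trans_lt ?_
      have h4 : (d / 4) ^ 2 = l * (n * P) / (16 * M ^ 2) := by
        rw [← hd2]; field_simp; norm_num
      rw [h4, lt_div_iff₀ (by positivity)]
      have := mul_lt_mul_of_pos_right hkq hn'
      linarith
  unfold Code.errorProb
  calc _ ≤ (M : ℝ≥0∞)⁻¹ * ∑ w : Fin M, B := by gcongr with w; exact key w
    _ = B := by
      rw [Finset.sum_const, Finset.card_univ, Fintype.card_fin, nsmul_eq_mul, ← mul_assoc,
        ENNReal.inv_mul_cancel (by exact_mod_cast hM.ne') (by simp), one_mul]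

lemma exists_bestErrorProb_le {M : ℕ} (hM : 0 < M) {P κ : ℝ} (hP : 0 < P) (hκ0 : 0 < κ)
    (hκ : κ < 1) : ∃ (k : ℕ) (K : ℝ) (a : ℝ), 0 < K ∧ 0 < a ∧ ∀ n : ℕ, k ≤ n → 0 < n →
      ∀ α : ℝ≥0, α ≤ a →
        bestErrorProb M n P α ≤ ENNReal.ofReal (K * Real.exp (-(κ ^ 2 * P / 2 * n))) := by
  obtain ⟨k, q, hq, h⟩ := exists_code_errorProb_le hM hP hκ0 hκ
  have hC := lintegral_exp_mul_sq_gaussianReal_lt_top (s := κ / 2) (by linarith)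
  set C := ∫⁻ x, ENNReal.ofReal (Real.exp (κ / 2 * x ^ 2)) ∂(gaussianReal 0 1) with hCdef
  have hC1 : 1 ≤ C := by
    calc (1 : ℝ≥0∞) = ∫⁻ x, 1 ∂(gaussianReal 0 1) := by simp
      _ ≤ C := lintegral_mono fun x => by
        rw [ENNReal.one_le_ofReal]
        exact Real.one_le_exp (by positivity)
  have hC0 : 0 < C.toReal := ENNReal.toReal_pos (by positivity) hC.ne
  -- The forward tail uses the Chernoff parameter κ/2, the feedback tail κ²P/(2q), so that the
  -- exponents agree. The latter has moment at most `C` when κ²P/(2q)·α ≤ κ/2, that is α ≤ q/(κP).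
  refine ⟨k, 2 * C.toReal ^ k, q / (κ * P), by positivity, by positivity,
    fun n hkn hn α hα => (h n hkn hn α).trans ?_⟩
  have hcard : (Finset.univ.filter fun i : Fin n => (i : ℕ) < k).card ≤ k := by
    rw [Fin.card_filter_val_lt]; exact min_le_right _ _
  have hm1 : ∀ t : ℝ, MeasurableSet
      {z : Fin n → ℝ | t < ∑ i with (i : Fin n).val < k, z i ^ 2} := fun t =>
    measurableSet_lt measurable_const (by fun_prop)
  have b1 : noise n α {ω | n * (κ * P) < ∑ i with (i : Fin n).val < k, ω.1 i ^ 2}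
      ≤ C ^ k * ENNReal.ofReal (Real.exp (-(κ ^ 2 * P / 2 * n))) := by
    have e : noise n α {ω | n * (κ * P) < ∑ i with (i : Fin n).val < k, ω.1 i ^ 2}
        = (Measure.pi fun _ : Fin n => gaussianReal 0 1)
          {z | n * (κ * P) < ∑ i with (i : Fin n).val < k, z i ^ 2} :=
      measurePreserving_fst.measure_preimage (hm1 _).nullMeasurableSet
    rw [e]
    refine (measure_pi_sum_sq_gt_le _ _ (c := κ / 2) (by positivity) _ hCdef.symm.le).trans ?_
    rw [show κ / 2 * (n * (κ * P)) = κ ^ 2 * P / 2 * n by ring]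
    gcongr
  have b2 : noise n α {ω | n * q < ∑ i with (i : Fin n).val < k, ω.2 i ^ 2}
      ≤ C ^ k * ENNReal.ofReal (Real.exp (-(κ ^ 2 * P / 2 * n))) := by
    have e : noise n α {ω | n * q < ∑ i with (i : Fin n).val < k, ω.2 i ^ 2}
        = (Measure.pi fun _ : Fin n => gaussianReal 0 α)
          {z | n * q < ∑ i with (i : Fin n).val < k, z i ^ 2} :=
      measurePreserving_snd.measure_preimage (hm1 _).nullMeasurableSet
    rw [e]
    have hc : κ ^ 2 * P / (2 * q) * α ≤ κ / 2 := by
      rw [le_div_iff₀ (by positivity)] at hα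
      rw [div_mul_eq_mul_div, div_le_iff₀ (by positivity)]
      have := mul_le_mul_of_nonneg_left hα hκ0.le
      linarith
    refine (measure_pi_sum_sq_gt_le _ _ (c := κ ^ 2 * P / (2 * q)) (by positivity) _
      (lintegral_exp_mul_sq_gaussianReal_le hc)).trans ?_
    rw [show κ ^ 2 * P / (2 * q) * (n * q) = κ ^ 2 * P / 2 * n by field_simp, ← hCdef]
    gcongr
  refine (add_le_add b1 b2).trans_eq ?_
  rw [ENNReal.ofReal_mul (by positivity), ENNReal.ofReal_mul (by norm_num),
    ENNReal.ofReal_pow ENNReal.toReal_nonneg, ENNReal.ofReal_toReal hC.ne, ENNReal.ofReal_ofNat]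
  ring

/-- For `κ` close to 1 the exponent κ²P/2 exceeds `c`, and the surplus absorbs the constant `K`. -/
lemma exists_le_errorExponent {M : ℕ} (hM : 0 < M) {P c : ℝ} (hP : 0 < P) (hc : c < P / 2) :
    ∃ a : ℝ, 0 < a ∧ ∀ α : ℝ≥0, α ≤ a → (c : EReal) ≤ errorExponent M P α := by
  obtain ⟨κ, ⟨hκ0, hκc⟩, hκ⟩ : ∃ κ : ℝ, (0 < κ ∧ c < κ ^ 2 * P / 2) ∧ κ < 1 := by
    have h1 : Tendsto (fun κ : ℝ => κ ^ 2 * P / 2) (𝓝[<] 1) (𝓝 (1 ^ 2 * P / 2)) :=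
      (Continuous.tendsto (by fun_prop) 1).mono_left nhdsWithin_le_nhds
    have h2 : ∀ᶠ κ : ℝ in 𝓝[<] 1, 0 < κ :=
      nhdsWithin_le_nhds (lt_mem_nhds (by norm_num))
    exact ((h2.and (h1.eventually_const_lt (by simpa using hc))).and
      self_mem_nhdsWithin).exists
  obtain ⟨k, K, a, hK, ha, h⟩ := exists_bestErrorProb_le hM hP hκ0 hκ
  refine ⟨a, ha, fun α hα => le_errorExponent_of_eventually ?_⟩
  have t := (tendsto_exp_neg_mul_nat (sub_pos.mpr hκc)).eventually_le_const (inv_pos.mpr hK)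
  filter_upwards [t, eventually_ge_atTop k, eventually_gt_atTop 0] with n hn hkn hn0
  refine (h n hkn hn0 α hα).trans (ENNReal.ofReal_le_ofReal ?_)
  rw [show -(κ ^ 2 * P / 2 * n) = -((κ ^ 2 * P / 2 - c) * n) + -(c * n) by ring, Real.exp_add,
    ← mul_assoc]
  refine mul_le_of_le_one_left (Real.exp_pos _).le ?_
  calc K * Real.exp (-((κ ^ 2 * P / 2 - c) * n)) ≤ K * K⁻¹ := by gcongr
    _ = 1 := mul_inv_cancel₀ hK.ne'

end GaussianFeedback

theorem corollary2 (M : ℕ) (hM : 2 ≤ M) (P : ℝ) (hP : 0 < P) :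
    Tendsto (fun α : ℝ≥0 => GaussianFeedback.errorExponent M P α) (𝓝[>] 0)
        (𝓝 (GaussianFeedback.errorExponent M P 0)) ∧
      GaussianFeedback.errorExponent M P 0 = ((P / 2 : ℝ) : EReal) := by
  -- The threshold `a` covers `α = 0` as well as small positive `α`, so the same two bounds give
  -- both the noise-free value and the limit.
  have h0 : GaussianFeedback.errorExponent M P 0 = ((P / 2 : ℝ) : EReal) := by
    refine le_antisymm (GaussianFeedback.errorExponent_le hM hP 0) ?_
    refine EReal.ge_of_forall_gt_iff_ge.mp fun c hc => ?_
    obtain ⟨a, ha, h⟩ := GaussianFeedback.exists_le_errorExponent (M := M) (by omega) hP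
      (EReal.coe_lt_coe_iff.mp hc)
    exact h 0 (by simpa using ha.le)
  refine ⟨?_, h0⟩
  rw [h0]
  refine tendsto_order.mpr ⟨fun x hx => ?_, fun x hx => Eventually.of_forall fun α =>
    (GaussianFeedback.errorExponent_le hM hP α).trans_lt hx⟩
  obtain ⟨c, hxc, hc⟩ := EReal.lt_iff_exists_real_btwn.mp hx
  obtain ⟨a, ha, h⟩ := GaussianFeedback.exists_le_errorExponent (M := M) (by omega) hP
    (EReal.coe_lt_coe_iff.mp hc)
  have ha' : (0 : ℝ≥0) < a.toNNReal := Real.toNNReal_pos.mpr ha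
  filter_upwards [nhdsWithin_le_nhds (Iic_mem_nhds ha')] with α hα
  exact hxc.trans_le (h α ((NNReal.coe_le_coe.mpr hα).trans_eq (Real.coe_toNNReal a ha.le)))
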